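/- **Model.** There are $k$ bandits and $L$ resource types. For each bandit $i$ there are a parameter set $\Theta_i$ and probability densities $f_i(\cdot\mid t)$, $t\in\Theta_i$, on $\mathbb R$ with respect to a common measure $v$, with finite means $\mu_i(t)$; let $\Theta=\Theta_1\times\dots\times\Theta_k$. Activating bandit $i$ uses the amount $c^i_j\in\mathbb R$ of resource $j$, and $c^0_j\in\mathbb R$ of resource $j$ is available per period. A policy $\pi$ is a sequence of probability kernels, not depending on $\theta$, which in each period $t$ select a bandit $A_t$ at random given the past activations and outcomes; given the past and $A_t=i$, the outcome $X_t$ has density $f_i(\cdot\mid\theta_i)$. Let $T^i_\pi(n)=\#\{t\le n: A_t=i\}$. The policy is *feasible* if, under every $\theta\in\Theta$, almost surely $\frac1n\sum_i c^i_jT^i_\pi(n)\le c^0_j$ for all $j\le L$ and all $n\ge1$. **Linear program.** Let $z^*(\theta)$ be the maximum of $\sum_i\mu_i(\theta_i)x_i$ over $x\in\mathbb R^k$, $y\in\mathbb R^L$ with $x,y\ge0$, $\sum_i c^i_jx_i+y_j=c^0_j$ $(j=1,\dots,L)$ and $\sum_ix_i=1$. The regret is $R_\pi(\theta,n)=n\,z^*(\theta)-E_\theta\big[\sum_{t\le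 n}X_t\big]$. A feasible policy is *uniformly fast* (f-UF) if $R_\pi(\theta,n)=o(n^a)$ as $n\to\infty$ for every $a>0$ and every $\theta\in\Theta$. For an invertible $(L+1)\times(L+1)$ matrix $B$ of columns of the constraint matrix, let $v^B=\mu_B(\theta)B^{-1}=(g^B_1,\dots,g^B_{L+1})$, where $\mu_B(\theta)$ is the vector of objective coefficients of the columns of $B$, and let $\phi^B_\alpha(\theta)=\sum_{j\le L}c^\alpha_jg^B_j+g^B_{L+1}-\mu_\alpha(\theta_\alpha)$ be the reduced costs. $B$ is an *optimal basis* under $\theta$ if its basic solution is feasible, $\phi^B_\alpha(\theta)\ge0$ for all $\alpha$, and $g^B_j\ge0$ for all $j\le L$. Let $O^*(\theta)$ be the family of the sets $b=\{i:x_i>0\}$, where $(x,y)$ ranges over the optimal basic feasible solutions under $\theta$. For $t\in\Theta_\alpha$ write $\theta^{\alpha\to t}$ for $\theta$ with $\theta_\alpha$ replaced by $t$. Put $$\Delta\Theta_\alpha(\theta)=\{t\in\Theta_\alpha:\ O^*(\theta^{\alpha\to t})=\{b\}\text{ for some } b\ni\alpha\},$$ $$D(\theta)=\{\alpha:\ \alpha\notin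 b\ \text{ for every } b\in O^*(\theta),\ \Delta\Theta_\alpha(\theta)\ne\emptyset\},$$ $$K_\alpha(\theta)=\inf_{t\in\Delta\Theta_\alpha(\theta)} I(\theta_\alpha,t)\in[0,\infty],$$ where $I(\theta_\alpha,t)\in[0,\infty]$ is the Kullback–Leibler divergence of $f_\alpha(\cdot\mid\theta_\alpha)$ from $f_\alpha(\cdot\mid t)$, that is, $\int\log\frac{f_\alpha(x\mid\theta_\alpha)}{f_\alpha(x\mid t)}f_\alpha(x\mid\theta_\alpha)\,dv(x)$. **Theorem 1.** If $\pi$ is an f-UF policy, then for every $\theta\in\Theta$ and every optimal basis $B$ under $\theta$, $$\liminf_{n\to\infty}\frac{R_\pi(\theta,n)}{\log n}\ \ge\ M(\theta)=\sum_{j\in D(\theta)}\frac{\phi^B_j(\theta)}{K_j(\theta)},$$ where terms with $\phi^B_j(\theta)=0$ or $K_j(\theta)=\infty$ are $0$, and terms with $\phi^B_j(\theta)>0$ and $K_j(\theta)=0$ are $+\infty$. -/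

import Mathlib

open MeasureTheory ProbabilityTheory Filter
open scoped ENNReal Matrix

noncomputable section

/-- `k` bandits and `L` resource types. The successive outcomes of bandit `i` under the parameter
`t : Θ i` have density `f i t` with respect to the common measure `ν`, with a finite mean.
`c i j` is the type-`j` cost of one activation of bandit `i`; `c₀ j` is the type-`j` budget per
period. -/
structure BanditModel (k L : ℕ) (Θ : Fin k → Type*) where
  ν : Measure ℝ
  f : (i : Fin k) → Θ i → ℝ → ℝ≥0∞
  measurable_f : ∀ i t, Measurable (f i t)
  lintegral_f : ∀ i t, ∫⁻ x, f i t x ∂ν = 1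
  integrable_id : ∀ i t, Integrable (fun x : ℝ => x) (ν.withDensity (f i t))
  c : Fin k → Fin L → ℝ
  c₀ : Fin L → ℝ

/-- A history of `n` periods: the activated bandit and the observed outcome in each period. -/
abbrev BanditHistory (k n : ℕ) : Type := Fin n → Fin k × ℝ

/-- An adaptive policy: given the history of the first `t` periods, a probability distribution
on the bandits, from which the next bandit is drawn. It does not know the parameters. -/
structure BanditPolicy (k : ℕ) where
  choice : (t : ℕ) → Kernel (BanditHistory k t) (Fin k)
  markov : ∀ t, IsMarkovKernel (choice t)

namespace BanditModel

variable {k L : ℕ} {Θ : Fin k → Type*} (S : BanditModel k L Θ)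

/-! ### Distributions of the bandits -/

/-- The law of one outcome of bandit `i` under `t`. -/
def law (i : Fin k) (t : Θ i) : Measure ℝ := S.ν.withDensity (S.f i t)

/-- The mean `μ_i(t)`. -/
def mean (i : Fin k) (t : Θ i) : ℝ := ∫ x, x ∂(S.law i t)

/-- The outcome law as a kernel from bandits to outcomes. -/
def armKernel (θ : ∀ i, Θ i) : Kernel (Fin k) ℝ where
  toFun i := S.law i (θ i)
  measurable' := measurable_of_finite _

/-- One period: draw the bandit from the policy, then the outcome from that bandit's law,
independently of the past given the bandit. -/
def stepKernel (π : BanditPolicy k) (θ : ∀ i, Θ i) (n : ℕ) :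
    Kernel (BanditHistory k n) (Fin k × ℝ) :=
  π.choice n ⊗ₖ Kernel.prodMkLeft (BanditHistory k n) (S.armKernel θ)

/-- The law of the history of the first `n` periods under policy `π` and parameters `θ`. -/
def histLaw (π : BanditPolicy k) (θ : ∀ i, Θ i) : (n : ℕ) → Measure (BanditHistory k n)
  | 0 => Measure.dirac Fin.elim0
  | n + 1 => (histLaw π θ n ⊗ₘ S.stepKernel π θ n).map
      (fun p => (Fin.snoc p.1 p.2 : BanditHistory k (n + 1)))

/-! ### The linear program -/

/-- Constraint matrix in the variables `x_i` (`Sum.inl i`) and the slacks `y_j` (`Sum.inr j`):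
the rows `∑ i, c i j * x i + y j` and the row `∑ i, x i`. -/
def lpMatrix : Matrix (Fin L ⊕ Unit) (Fin k ⊕ Fin L) ℝ :=
  Matrix.fromBlocks (Matrix.of fun j i => S.c i j) 1 (Matrix.of fun _ _ => 1) 0

/-- Right-hand side `(c₀, 1)`. -/
def lpRhs : Fin L ⊕ Unit → ℝ := Sum.elim S.c₀ (fun _ => 1)

/-- Objective coefficients `(μ(θ), 0)`. -/
def lpObj (θ : ∀ i, Θ i) : Fin k ⊕ Fin L → ℝ := Sum.elim (fun i => S.mean i (θ i)) (fun _ => 0)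

/-- Feasible points `(x, y)` of the LP. -/
def lpFeasible : Set (Fin k ⊕ Fin L → ℝ) :=
  {w | S.lpMatrix *ᵥ w = S.lpRhs ∧ ∀ i, 0 ≤ w i}

/-- The optimal value `z*(θ)`. -/
def zStar (θ : ∀ i, Θ i) : ℝ := sSup ((fun w => S.lpObj θ ⬝ᵥ w) '' S.lpFeasible)

/-- The square matrix formed by the columns `e`. -/
def basisMatrix (e : Fin L ⊕ Unit → Fin k ⊕ Fin L) : Matrix (Fin L ⊕ Unit) (Fin L ⊕ Unit) ℝ :=
  S.lpMatrix.submatrix id e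

/-- `w` is the basic feasible solution of the basis with columns `e`. -/
def IsBFSOf (e : Fin L ⊕ Unit → Fin k ⊕ Fin L) (w : Fin k ⊕ Fin L → ℝ) : Prop :=
  IsUnit (S.basisMatrix e).det ∧ w ∈ S.lpFeasible ∧ ∀ i, i ∉ Set.range e → w i = 0

/-- `w` is an optimal solution of the LP under `θ`. -/
def IsLPOptimal (θ : ∀ i, Θ i) (w : Fin k ⊕ Fin L → ℝ) : Prop :=
  w ∈ S.lpFeasible ∧ ∀ w' ∈ S.lpFeasible, S.lpObj θ ⬝ᵥ w' ≤ S.lpObj θ ⬝ᵥ w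

/-- The bandits that are activated with positive probability by the solution `w`. -/
def activeBandits (w : Fin k ⊕ Fin L → ℝ) : Finset (Fin k) :=
  {i | 0 < w (Sum.inl i)}

/-- `O*(θ)`: the sets of bandits used by the optimal basic feasible solutions. -/
def optSets (θ : ∀ i, Θ i) : Set (Finset (Fin k)) :=
  {b | ∃ e w, S.IsBFSOf e w ∧ S.IsLPOptimal θ w ∧ b = activeBandits w}

/-- The dual vector `v^B = μ_B B⁻¹ = (g^B_1, …, g^B_L, g^B_{L+1})`. -/
def dualVec (θ : ∀ i, Θ i) (e : Fin L ⊕ Unit → Fin k ⊕ Fin L) : Fin L ⊕ Unit → ℝ :=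
  (fun r => S.lpObj θ (e r)) ᵥ* (S.basisMatrix e)⁻¹

/-- The reduced cost `φ^B_α(θ) = ∑ j, c^α_j g^B_j + g^B_{L+1} - μ_α(θ_α)`. -/
def reducedCost (θ : ∀ i, Θ i) (e : Fin L ⊕ Unit → Fin k ⊕ Fin L) (α : Fin k) : ℝ :=
  ∑ j, S.c α j * S.dualVec θ e (Sum.inl j) + S.dualVec θ e (Sum.inr ()) - S.mean α (θ α)

/-- An optimal basis: an invertible basic matrix whose basic solution is feasible and for which
all reduced costs (`φ^B_α` for the bandits, `g^B_j` for the slacks) are nonnegative. -/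
def IsOptimalBasis (θ : ∀ i, Θ i) (e : Fin L ⊕ Unit → Fin k ⊕ Fin L) : Prop :=
  (∃ w, S.IsBFSOf e w) ∧ (∀ α, 0 ≤ S.reducedCost θ e α) ∧ ∀ j, 0 ≤ S.dualVec θ e (Sum.inl j)

/-! ### Feasible and uniformly fast policies -/

/-- `T^α(n)`: the number of activations of `α` in the history. -/
def pulls {n : ℕ} (h : BanditHistory k n) (α : Fin k) : ℕ :=
  Finset.card {t : Fin n | (h t).1 = α}

/-- Total type-`j` cost. -/
def totalCost {n : ℕ} (h : BanditHistory k n) (j : Fin L) : ℝ :=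
  ∑ i, (pulls h i : ℝ) * S.c i j

/-- Total reward. -/
def totalReward {n : ℕ} (h : BanditHistory k n) : ℝ := ∑ t, (h t).2

/-- The policy respects every budget at every time, with probability one. -/
def IsFeasible (π : BanditPolicy k) : Prop :=
  ∀ (θ : ∀ i, Θ i) (n : ℕ), 1 ≤ n → ∀ᵐ h ∂(S.histLaw π θ n), ∀ j, S.totalCost h j / n ≤ S.c₀ j

/-- The regret `n z*(θ) - E_θ V_π(n)`. -/
def regret (π : BanditPolicy k) (θ : ∀ i, Θ i) (n : ℕ) : ℝ :=
  n * S.zStar θ - ∫ h, totalReward h ∂(S.histLaw π θ n)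

/-- Feasible and uniformly fast: the regret is `o(n^a)` for all `a > 0`, for all parameters. -/
def IsFUF (π : BanditPolicy k) : Prop :=
  S.IsFeasible π ∧ ∀ (θ : ∀ i, Θ i) (a : ℝ), 0 < a →
    (fun n : ℕ => S.regret π θ n) =o[atTop] (fun n : ℕ => (n : ℝ) ^ a)

/-! ### The constant of the lower bound -/

/-- `ΔΘ_α(θ)`: the parameters of `α` under which, the other parameters being unchanged, there is
a unique optimal set of bandits, and it contains `α`. -/
def deltaTheta (θ : ∀ i, Θ i) (α : Fin k) : Set (Θ α) :=
  {t | ∃ b : Finset (Fin k), α ∈ b ∧ S.optSets (Function.update θ α t) = {b}}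

/-- `D(θ)`. -/
def critical (θ : ∀ i, Θ i) : Set (Fin k) :=
  {α | (∀ b ∈ S.optSets θ, α ∉ b) ∧ (S.deltaTheta θ α).Nonempty}

/-- `K_α(θ)`, the infimum of the Kullback-Leibler divergences; it may be `0` or `∞`. -/
def minKL (θ : ∀ i, Θ i) (α : Fin k) : ℝ≥0∞ :=
  ⨅ t ∈ S.deltaTheta θ α, InformationTheory.klDiv (S.law α (θ α)) (S.law α t)

open Classical in
/-- `M(θ) = ∑_{j ∈ D(θ)} φ^B_j(θ) / K_j(θ)` for the basis `e`, in `[0, ∞]`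
(for nonnegative reduced costs; `0 / 0 = 0`, `x / 0 = ∞` for `x > 0`, `x / ∞ = 0`). -/
def lowerBound (θ : ∀ i, Θ i) (e : Fin L ⊕ Unit → Fin k ⊕ Fin L) : ℝ≥0∞ :=
  ∑ j with j ∈ S.critical θ, ENNReal.ofReal (S.reducedCost θ e j) / S.minKL θ j

end BanditModel

end

/-!
The regret is bounded below through duality: for an optimal basis `B` under `θ`, the dual value
`v · (c₀, 1)` is attained by the basic solution, so on every history within the budgets the
shortfall `n z* - ∑ i, T_i μ_i` is at least `∑ i, φ_i T_i` (`sum_reducedCost_mul_le_regret`).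
It then remains to show that `E_θ T_α(n)` is asymptotically at least `log n / I(θ_α, t)` for every `t` in
`ΔΘ_α(θ)` (`eventually_mul_log_le_integral_pulls`).

Let `θ'` be `θ` with `θ_α` replaced by such a `t`. The only optimal set under `θ'` contains `α`. By
an extreme point argument no optimal solution whatever gives weight `0` to `α`
(`pos_of_isLPOptimal`), and by compactness there is `m > 0` such that every feasible solution with
weight less than `m` on `α` falls short of `z*(θ')` by at least `m` (`exists_pos_le_or_le_gap`).
The event `E` that `T_α(n) < m n` therefore has `P_θ'(E) ≤ R(θ', n) / (m n)`, which is
`o(n ^ (a - 1))` for every `a > 0`. Under `θ`, on the other hand, Markov's inequality gives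
`P_θ(Eᶜ) ≤ E_θ T_α(n) / (m n)`, which tends to `0` if `E_θ T_α(n)` is of order `log n`.

The two laws of the history differ only in the outcomes of `α`, so by Wald's identity
(`integral_sum_history`) the expectation under `P_θ` of their log-likelihood ratio is
`I(θ_α, t) E_θ T_α(n)`. Taking expectations in `1 + u ≤ exp u`, with `u` equal to `l 1_E` minus this
ratio, gives `l P_θ(E) ≤ I(θ_α, t) E_θ T_α(n) + exp l · P_θ'(E)`
(`mul_measureReal_le_klDiv_mul_add`). With `l = b log n` and `b < 1` the last term vanishes in the
limit, and `E_θ T_α(n) < c log n` is impossible for large `n` whenever `c I(θ_α, t) < b`.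
-/

namespace BanditModel

variable {k L : ℕ} {Θ : Fin k → Type*} (S : BanditModel k L Θ)

/-! ### Linear programming -/

lemma lpMatrix_mulVec_inl (w : Fin k ⊕ Fin L → ℝ) (j : Fin L) :
    (S.lpMatrix *ᵥ w) (Sum.inl j) = ∑ i, S.c i j * w (Sum.inl i) + w (Sum.inr j) := by
  simp [lpMatrix, Matrix.mulVec, dotProduct, Matrix.one_apply]

lemma lpMatrix_mulVec_inr (w : Fin k ⊕ Fin L → ℝ) :
    (S.lpMatrix *ᵥ w) (Sum.inr ()) = ∑ i, w (Sum.inl i) := by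
  simp [lpMatrix, Matrix.mulVec, dotProduct]

lemma lpObj_dotProduct (θ : ∀ i, Θ i) (w : Fin k ⊕ Fin L → ℝ) :
    S.lpObj θ ⬝ᵥ w = ∑ i, S.mean i (θ i) * w (Sum.inl i) := by
  simp [lpObj, dotProduct]

lemma mem_lpFeasible_iff (w : Fin k ⊕ Fin L → ℝ) :
    w ∈ S.lpFeasible ↔ (∀ j, ∑ i, S.c i j * w (Sum.inl i) + w (Sum.inr j) = S.c₀ j) ∧
      ∑ i, w (Sum.inl i) = 1 ∧ ∀ i, 0 ≤ w i := by
  constructor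
  · rintro ⟨h1, h2⟩
    refine ⟨fun j => ?_, ?_, h2⟩
    · rw [← lpMatrix_mulVec_inl, h1]; rfl
    · rw [← lpMatrix_mulVec_inr, h1]; rfl
  · rintro ⟨h1, h2, h3⟩
    refine ⟨?_, h3⟩
    ext r
    rcases r with j | u
    · rw [lpMatrix_mulVec_inl, h1]; rfl
    · rw [lpMatrix_mulVec_inr, h2]; rfl

lemma isCompact_lpFeasible : IsCompact S.lpFeasible := by
  have hclosed : IsClosed S.lpFeasible := by
    refine IsClosed.inter (isClosed_eq (by fun_prop) continuous_const) ?_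
    exact isClosed_Ici (a := (0 : Fin k ⊕ Fin L → ℝ))
  refine (isCompact_univ_pi (s := fun i : Fin k ⊕ Fin L => Set.Icc (0 : ℝ)
    (Sum.elim (fun _ => 1) (fun j => S.c₀ j + ∑ i, |S.c i j|) i))
    fun i => isCompact_Icc).of_isClosed_subset hclosed ?_
  intro w hw i _
  rw [mem_lpFeasible_iff] at hw
  obtain ⟨h1, h2, h3⟩ := hw
  have hle : ∀ i, w (Sum.inl i) ≤ 1 := fun i => by
    rw [← h2]
    exact Finset.single_le_sum (f := fun i => w (Sum.inl i)) (fun i _ => h3 _) (Finset.mem_univ i)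
  refine ⟨h3 i, ?_⟩
  rcases i with i | j
  · exact hle i
  · have : -∑ i, |S.c i j| ≤ ∑ i, S.c i j * w (Sum.inl i) := by
      rw [← Finset.sum_neg_distrib]
      refine Finset.sum_le_sum fun i _ => ?_
      have := neg_abs_le (S.c i j * w (Sum.inl i))
      rw [abs_mul, abs_of_nonneg (h3 (Sum.inl i))] at this
      nlinarith [mul_le_mul_of_nonneg_left (hle i) (abs_nonneg (S.c i j))]
    have := h1 j
    simp only [Sum.elim_inr]
    linarith

lemma le_zStar (θ : ∀ i, Θ i) {w : Fin k ⊕ Fin L → ℝ} (hw : w ∈ S.lpFeasible) :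
    S.lpObj θ ⬝ᵥ w ≤ S.zStar θ := by
  refine le_csSup ?_ (Set.mem_image_of_mem _ hw)
  exact S.isCompact_lpFeasible.bddAbove_image
    (Continuous.continuousOn (by unfold dotProduct; fun_prop))

lemma isLPOptimal_of_zStar_le (θ : ∀ i, Θ i) {w : Fin k ⊕ Fin L → ℝ} (hw : w ∈ S.lpFeasible)
    (h : S.zStar θ ≤ S.lpObj θ ⬝ᵥ w) : S.IsLPOptimal θ w :=
  ⟨hw, fun _ hw' => (S.le_zStar θ hw').trans h⟩

/-- Since `v B = μ_B` and the basic solution vanishes off the columns of `B`, its objective value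
equals the dual value `v · (c₀, 1)`. -/
lemma dualVec_dotProduct_le_zStar (θ : ∀ i, Θ i) {e : Fin L ⊕ Unit → Fin k ⊕ Fin L}
    {w : Fin k ⊕ Fin L → ℝ} (hw : S.IsBFSOf e w) :
    S.dualVec θ e ⬝ᵥ S.lpRhs ≤ S.zStar θ := by
  obtain ⟨hdet, hfeas, hzero⟩ := hw
  refine le_of_eq_of_le ?_ (S.le_zStar θ hfeas)
  rw [← hfeas.1, Matrix.dotProduct_mulVec]
  have hvB : S.dualVec θ e ᵥ* S.basisMatrix e = fun r => S.lpObj θ (e r) := by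
    rw [dualVec, Matrix.vecMul_vecMul, Matrix.nonsing_inv_mul _ hdet, Matrix.vecMul_one]
  refine Finset.sum_congr rfl fun i _ => ?_
  by_cases hi : i ∈ Set.range e
  · obtain ⟨r, rfl⟩ := hi
    have := congrFun hvB r
    simp only [Matrix.vecMul, dotProduct, basisMatrix, Matrix.submatrix_apply, id] at this
    simp only [Matrix.vecMul, dotProduct, this]
  · rw [hzero i hi, mul_zero, mul_zero]

/-- Linearly independent columns of the constraint matrix can be completed to a basis: with at
least one bandit the matrix has full row rank. -/
lemma exists_basis_of_linearIndepOn (α : Fin k) {s : Set (Fin k ⊕ Fin L)}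
    (hs : LinearIndepOn ℝ S.lpMatrix.col s) :
    ∃ e : Fin L ⊕ Unit → Fin k ⊕ Fin L, IsUnit (S.basisMatrix e).det ∧ s ⊆ Set.range e := by
  have hinr : ∀ j, S.lpMatrix.col (Sum.inr j) = Pi.single (Sum.inl j) 1 := by
    intro j
    ext r
    rcases r with j' | u <;>
      simp [lpMatrix, Matrix.col, Matrix.one_apply, Pi.single_apply]
  have hspan : Submodule.span ℝ (S.lpMatrix.col '' Set.univ) = ⊤ := by
    rw [eq_top_iff, ← (Pi.basisFun ℝ (Fin L ⊕ Unit)).span_eq, Submodule.span_le]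
    have hj : ∀ j : Fin L, (Pi.single (Sum.inl j) 1 : Fin L ⊕ Unit → ℝ) ∈
        Submodule.span ℝ (S.lpMatrix.col '' Set.univ) := fun j => by
      rw [← hinr]
      exact Submodule.subset_span ⟨_, trivial, rfl⟩
    rintro _ ⟨r, rfl⟩
    rw [Pi.basisFun_apply]
    rcases r with j | u
    · exact hj j
    · have : (Pi.single (Sum.inr u) 1 : Fin L ⊕ Unit → ℝ) = S.lpMatrix.col (Sum.inl α) -
          ∑ j, S.c α j • (Pi.single (Sum.inl j) 1 : Fin L ⊕ Unit → ℝ) := by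
        ext r
        rcases r with j' | u' <;> simp [lpMatrix, Matrix.col, Pi.single_apply]
      rw [this]
      refine Submodule.sub_mem _ (Submodule.subset_span ⟨_, trivial, rfl⟩)
        (Submodule.sum_mem _ fun j _ => Submodule.smul_mem _ _ (hj j))
  set t := hs.extend (Set.subset_univ s)
  have ht : LinearIndepOn ℝ S.lpMatrix.col t := hs.linearIndepOn_extend _
  have hbasis : ⊤ ≤ Submodule.span ℝ (Set.range fun i : t => S.lpMatrix.col i) := by
    have hr : (Set.range fun i : t => S.lpMatrix.col i) = S.lpMatrix.col '' t := by
      ext; simp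
    rw [hr, ← hspan]
    exact (hs.span_image_extend_eq_span_image _).ge
  let b := Module.Basis.mk ht hbasis
  let ε : Fin L ⊕ Unit ≃ t := (Pi.basisFun ℝ (Fin L ⊕ Unit)).indexEquiv b
  refine ⟨fun r => ε r, ?_, fun i hi => ?_⟩
  · rw [← Matrix.isUnit_iff_isUnit_det, ← Matrix.linearIndependent_cols_iff_isUnit]
    exact (linearIndependent_equiv ε).2 ht
  · exact ⟨ε.symm ⟨i, hs.subset_extend _ hi⟩, by simp⟩

/-- If `α` belongs to every optimal set, then no optimal solution, basic or not, gives weight `0`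
to `α`: an extreme point of the face of such solutions would be a basic feasible solution. -/
lemma pos_of_isLPOptimal {θ : ∀ i, Θ i} {α : Fin k} (hα : ∀ b ∈ S.optSets θ, α ∈ b)
    {w : Fin k ⊕ Fin L → ℝ} (hw : S.IsLPOptimal θ w) : 0 < w (Sum.inl α) := by
  by_contra hneg
  have hw0 : w (Sum.inl α) = 0 := le_antisymm (not_lt.1 hneg) (hw.1.2 _)
  let F : Set (Fin k ⊕ Fin L → ℝ) :=
    S.lpFeasible ∩ {u | S.lpObj θ ⬝ᵥ w ≤ S.lpObj θ ⬝ᵥ u ∧ u (Sum.inl α) = 0}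
  have hF : IsCompact F := by
    have hc : Continuous fun u : Fin k ⊕ Fin L → ℝ => S.lpObj θ ⬝ᵥ u := by
      unfold dotProduct; fun_prop
    refine S.isCompact_lpFeasible.inter_right (IsClosed.inter ?_ ?_)
    · exact isClosed_le continuous_const hc
    · exact isClosed_eq (by fun_prop) continuous_const
  obtain ⟨u, hu⟩ := hF.extremePoints_nonempty ⟨w, hw.1, le_rfl, hw0⟩
  rw [mem_extremePoints] at hu
  obtain ⟨⟨hufeas, huopt, hu0⟩, hext⟩ := hu
  have hind : LinearIndepOn ℝ S.lpMatrix.col {i | 0 < u i} := by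
    rw [linearIndepOn_iff]
    intro l hl hl0
    have hlz : ∀ i, ¬ 0 < u i → l i = 0 := fun i hi => by
      by_contra h
      exact hi (hl (Finsupp.mem_support_iff.2 h))
    let z : Fin k ⊕ Fin L → ℝ := l
    have hAz : S.lpMatrix *ᵥ z = 0 := by
      rw [← hl0, Finsupp.linearCombination_apply, Finsupp.sum_fintype _ _ (by simp)]
      ext r
      simp [Matrix.mulVec, dotProduct, Matrix.col, z, mul_comm]
    have hev : ∀ᶠ s : ℝ in nhds 0, ∀ i, 0 ≤ u i + s * z i := by
      rw [eventually_all]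
      intro i
      by_cases hi : 0 < u i
      · have hc : Tendsto (fun s : ℝ => u i + s * z i) (nhds 0) (nhds (u i + 0 * z i)) :=
          Continuous.tendsto (by fun_prop) 0
        rw [zero_mul, add_zero] at hc
        exact (hc.eventually (lt_mem_nhds hi)).mono fun s hs => hs.le
      · exact Eventually.of_forall fun s => by
          rw [show z i = 0 from hlz i hi, mul_zero, add_zero]; exact hufeas.2 i
    have hev' : ∀ᶠ s : ℝ in nhds 0, ∀ i, 0 ≤ u i + (-s) * z i :=
      (continuous_neg.tendsto' (0 : ℝ) 0 neg_zero).eventually hev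
    obtain ⟨s, ⟨hs1, hs2⟩, hs0⟩ :
        ∃ s : ℝ, ((∀ i, 0 ≤ u i + s * z i) ∧ ∀ i, 0 ≤ u i + (-s) * z i) ∧ 0 < s := by
      have := ((hev.and hev').filter_mono (nhdsWithin_le_nhds (s := Set.Ioi (0 : ℝ)))).and
        self_mem_nhdsWithin
      exact this.exists
    have hfe : ∀ s : ℝ, (∀ i, 0 ≤ u i + s * z i) → u + s • z ∈ S.lpFeasible := fun s h =>
      ⟨by rw [Matrix.mulVec_add, Matrix.mulVec_smul, hAz, smul_zero, add_zero, hufeas.1], h⟩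
    have hop : ∀ s : ℝ, S.lpObj θ ⬝ᵥ (u + s • z) = S.lpObj θ ⬝ᵥ u + s * (S.lpObj θ ⬝ᵥ z) :=
      fun s => by rw [dotProduct_add, dotProduct_smul, smul_eq_mul]
    -- both `u + s z` and `u - s z` are feasible, so that the objective is constant along `z`
    have hobj : S.lpObj θ ⬝ᵥ z = 0 := by
      have h1 := (hw.2 _ (hfe _ hs1)).trans huopt
      have h2 := (hw.2 _ (hfe _ hs2)).trans huopt
      rw [hop] at h1 h2
      nlinarith
    have hmem : ∀ s : ℝ, (∀ i, 0 ≤ u i + s * z i) → u + s • z ∈ F := fun s h => by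
      refine ⟨hfe s h, ?_, ?_⟩
      · rw [hop, hobj, mul_zero, add_zero]; exact huopt
      · have : z (Sum.inl α) = 0 := hlz _ (by rw [hu0]; exact lt_irrefl 0)
        simp [hu0, this]
    have hzero := (hext _ (hmem _ hs1) _ (hmem _ hs2)
      ⟨1 / 2, 1 / 2, by norm_num, by norm_num, by norm_num, by ext i; simp; ring⟩).1
    ext i
    have hi := congrFun hzero i
    simpa [hs0.ne', z] using hi
  obtain ⟨e, hdet, hse⟩ := S.exists_basis_of_linearIndepOn α hind
  have hbfs : S.IsBFSOf e u := ⟨hdet, hufeas, fun i hi =>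
    le_antisymm (not_lt.1 fun h => hi (hse h)) (hufeas.2 i)⟩
  have := hα _ ⟨e, u, hbfs, ⟨hufeas, fun w' hw' => (hw.2 w' hw').trans huopt⟩, rfl⟩
  simp [activeBandits, hu0] at this

/-- If `α` belongs to every optimal set, then a feasible solution gives weight at least `m` to `α`
or falls short of the optimal value by at least `m`. -/
lemma exists_pos_le_or_le_gap {θ : ∀ i, Θ i} {α : Fin k} (hα : ∀ b ∈ S.optSets θ, α ∈ b) :
    ∃ m : ℝ, 0 < m ∧ ∀ w ∈ S.lpFeasible,
      m ≤ w (Sum.inl α) ∨ m ≤ S.zStar θ - S.lpObj θ ⬝ᵥ w := by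
  rcases S.lpFeasible.eq_empty_or_nonempty with he | hne
  · exact ⟨1, one_pos, fun w hw => by simp [he] at hw⟩
  obtain ⟨w₀, hw₀, hmin⟩ := S.isCompact_lpFeasible.exists_isMinOn hne
    (f := fun w => max (w (Sum.inl α)) (S.zStar θ - S.lpObj θ ⬝ᵥ w))
    (Continuous.continuousOn (by unfold dotProduct; fun_prop))
  refine ⟨_, ?_, fun w hw => le_max_iff.1 (hmin hw)⟩
  rw [lt_max_iff]
  by_contra! h
  have hopt := S.isLPOptimal_of_zStar_le θ hw₀ (sub_nonpos.1 h.2)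
  exact absurd (S.pos_of_isLPOptimal hα hopt) (not_lt.2 h.1)

end BanditModel

/-! ### Change of measure -/

/-- The reciprocal of the likelihood ratio integrates as a change of measure; the inequality may be
strict because `ν` need not be absolutely continuous with respect to `μ`. -/
lemma lintegral_mul_exp_neg_llr_le {Ω : Type*} [MeasurableSpace Ω] {μ ν : Measure Ω}
    [IsProbabilityMeasure μ] [IsProbabilityMeasure ν] (hμν : μ ≪ ν) {F : Ω → ℝ≥0∞}
    (hF : Measurable F) :
    ∫⁻ x, F x * ENNReal.ofReal (Real.exp (-llr μ ν x)) ∂μ ≤ ∫⁻ x, F x ∂ν := by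
  have hm : Measurable fun x => F x * ENNReal.ofReal (Real.exp (-llr μ ν x)) :=
    hF.mul (measurable_llr μ ν).neg.exp.ennreal_ofReal
  rw [← lintegral_rnDeriv_mul hμν hm.aemeasurable]
  refine lintegral_mono_ae ?_
  filter_upwards [μ.rnDeriv_lt_top ν] with x hx
  by_cases h0 : μ.rnDeriv ν x = 0
  · simp [h0]
  · have hpos : 0 < (μ.rnDeriv ν x).toReal := ENNReal.toReal_pos h0 hx.ne
    rw [llr, Real.exp_neg, Real.exp_log hpos, ENNReal.ofReal_inv_of_pos hpos,
      ENNReal.ofReal_toReal hx.ne, mul_left_comm, ENNReal.mul_inv_cancel h0 hx.ne, mul_one]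

namespace BanditModel

variable {k L : ℕ} {Θ : Fin k → Type*} (S : BanditModel k L Θ)

/-! ### The law of the history -/

instance (i : Fin k) (t : Θ i) : IsProbabilityMeasure (S.law i t) :=
  ⟨by rw [law, withDensity_apply _ MeasurableSet.univ, setLIntegral_univ, S.lintegral_f]⟩

instance (θ : ∀ i, Θ i) : IsMarkovKernel (S.armKernel θ) :=
  ⟨fun i => inferInstanceAs (IsProbabilityMeasure (S.law i (θ i)))⟩

instance (π : BanditPolicy k) (n : ℕ) : IsMarkovKernel (π.choice n) := π.markov n

instance (π : BanditPolicy k) (θ : ∀ i, Θ i) (n : ℕ) : IsMarkovKernel (S.stepKernel π θ n) := by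
  unfold stepKernel; infer_instance

lemma measurable_historySnoc (n : ℕ) :
    Measurable (fun p : BanditHistory k n × (Fin k × ℝ) =>
      (Fin.snoc p.1 p.2 : BanditHistory k (n + 1))) := by
  refine measurable_pi_iff.2 fun i => ?_
  refine Fin.lastCases ?_ (fun i => ?_) i
  · simpa using measurable_snd
  · simp only [Fin.snoc_castSucc]
    exact (measurable_pi_apply i).comp measurable_fst

instance (π : BanditPolicy k) (θ : ∀ i, Θ i) (n : ℕ) :
    IsProbabilityMeasure (S.histLaw π θ n) := by
  induction n with
  | zero => unfold histLaw; infer_instance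
  | succ n ih =>
    rw [histLaw]
    exact Measure.isProbabilityMeasure_map (measurable_historySnoc n).aemeasurable

lemma lintegral_stepKernel (π : BanditPolicy k) (θ : ∀ i, Θ i) (n : ℕ) (h : BanditHistory k n)
    {F : Fin k × ℝ → ℝ≥0∞} (hF : Measurable F) :
    ∫⁻ p, F p ∂(S.stepKernel π θ n h) =
      ∫⁻ i, ∫⁻ x, F (i, x) ∂(S.law i (θ i)) ∂(π.choice n h) := by
  rw [stepKernel, Kernel.lintegral_compProd _ _ _ hF]
  rfl

lemma lintegral_histLaw_succ (π : BanditPolicy k) (θ : ∀ i, Θ i) (n : ℕ)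
    {F : BanditHistory k (n + 1) → ℝ≥0∞} (hF : Measurable F) :
    ∫⁻ h, F h ∂(S.histLaw π θ (n + 1)) =
      ∫⁻ h, ∫⁻ p, F (Fin.snoc h p : BanditHistory k (n + 1)) ∂(S.stepKernel π θ n h)
        ∂(S.histLaw π θ n) := by
  rw [histLaw, lintegral_map hF (measurable_historySnoc n)]
  exact Measure.lintegral_compProd (hF.comp (measurable_historySnoc n))

lemma lintegral_enorm_stepKernel_le (π : BanditPolicy k) (θ : ∀ i, Θ i) (n : ℕ)
    (h : BanditHistory k n) {g : Fin k × ℝ → ℝ} (hg : Measurable g) :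
    ∫⁻ p, ‖g p‖ₑ ∂(S.stepKernel π θ n h) ≤ ∑ i, ∫⁻ x, ‖g (i, x)‖ₑ ∂(S.law i (θ i)) := by
  rw [S.lintegral_stepKernel π θ n h hg.enorm]
  calc _ ≤ ∫⁻ _, ∑ i, ∫⁻ x, ‖g (i, x)‖ₑ ∂(S.law i (θ i)) ∂(π.choice n h) :=
        lintegral_mono fun i => Finset.single_le_sum
          (f := fun i => ∫⁻ x, ‖g (i, x)‖ₑ ∂(S.law i (θ i))) (fun _ _ => zero_le)
          (Finset.mem_univ i)
    _ = _ := by simp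

lemma integrable_snd_compProd_stepKernel (π : BanditPolicy k) (θ : ∀ i, Θ i) (n : ℕ)
    {g : Fin k × ℝ → ℝ} (hg : Measurable g)
    (hint : ∀ i, Integrable (fun x => g (i, x)) (S.law i (θ i))) :
    Integrable (fun q : BanditHistory k n × (Fin k × ℝ) => g q.2)
      (S.histLaw π θ n ⊗ₘ S.stepKernel π θ n) := by
  refine ⟨(hg.comp measurable_snd).aestronglyMeasurable, ?_⟩
  rw [hasFiniteIntegral_iff_enorm,
    Measure.lintegral_compProd (f := fun q => ‖g q.2‖ₑ) (hg.comp measurable_snd).enorm]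
  calc _ ≤ ∫⁻ _, ∑ i, ∫⁻ x, ‖g (i, x)‖ₑ ∂(S.law i (θ i)) ∂(S.histLaw π θ n) :=
        lintegral_mono fun h => S.lintegral_enorm_stepKernel_le π θ n h hg
    _ = ∑ i, ∫⁻ x, ‖g (i, x)‖ₑ ∂(S.law i (θ i)) := by simp
    _ < ∞ := ENNReal.sum_lt_top.2 fun i _ => (hint i).2

lemma sum_historySnoc {n : ℕ} (g : Fin k × ℝ → ℝ) (h : BanditHistory k n) (p : Fin k × ℝ) :
    ∑ t, g ((Fin.snoc h p : BanditHistory k (n + 1)) t) = ∑ t, g (h t) + g p := by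
  rw [Fin.sum_univ_castSucc]
  simp

lemma integrable_sum_history (π : BanditPolicy k) (θ : ∀ i, Θ i) (n : ℕ)
    {g : Fin k × ℝ → ℝ} (hg : Measurable g)
    (hint : ∀ i, Integrable (fun x => g (i, x)) (S.law i (θ i))) :
    Integrable (fun h => ∑ t, g (h t)) (S.histLaw π θ n) := by
  induction n with
  | zero => simp
  | succ n ih =>
    have hm : Measurable fun h : BanditHistory k (n + 1) => ∑ t, g (h t) := by fun_prop
    rw [histLaw, integrable_map_measure hm.aestronglyMeasurable
      (measurable_historySnoc n).aemeasurable]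
    simp only [Function.comp_def, sum_historySnoc]
    refine Integrable.add ?_ (S.integrable_snd_compProd_stepKernel π θ n hg hint)
    rw [← Measure.fst_compProd (S.histLaw π θ n) (S.stepKernel π θ n)] at ih
    exact ih.comp_measurable measurable_fst

/-- Wald's identity: in expectation, each outcome may be replaced by its conditional mean given the
activated bandit. -/
lemma integral_sum_history (π : BanditPolicy k) (θ : ∀ i, Θ i) (n : ℕ)
    {g : Fin k × ℝ → ℝ} (hg : Measurable g)
    (hint : ∀ i, Integrable (fun x => g (i, x)) (S.law i (θ i))) :
    ∫ h, ∑ t, g (h t) ∂(S.histLaw π θ n) =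
      ∫ h, ∑ t, ∫ x, g ((h t).1, x) ∂(S.law (h t).1 (θ (h t).1)) ∂(S.histLaw π θ n) := by
  set m : Fin k × ℝ → ℝ := fun p => ∫ x, g (p.1, x) ∂(S.law p.1 (θ p.1)) with hmdef
  have hm : Measurable m := (measurable_of_finite fun i : Fin k =>
    ∫ x, g (i, x) ∂(S.law i (θ i))).comp measurable_fst
  have hmint : ∀ i, Integrable (fun x => m (i, x)) (S.law i (θ i)) := fun i =>
    integrable_const (m (i, 0))
  have hstep : ∀ n (u : Fin k × ℝ → ℝ), Measurable u →
      (∀ i, Integrable (fun x => u (i, x)) (S.law i (θ i))) →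
      ∫ h, ∑ t, u (h t) ∂(S.histLaw π θ (n + 1)) = ∫ h, ∑ t, u (h t) ∂(S.histLaw π θ n) +
        ∫ h, ∫ i, ∫ x, u (i, x) ∂(S.law i (θ i)) ∂(π.choice n h) ∂(S.histLaw π θ n) := by
    intro n u hu huint
    have hum : Measurable fun h : BanditHistory k (n + 1) => ∑ t, u (h t) := by fun_prop
    have h1 : Integrable (fun q : BanditHistory k n × (Fin k × ℝ) => ∑ t, u (q.1 t))
        (S.histLaw π θ n ⊗ₘ S.stepKernel π θ n) := by
      have := S.integrable_sum_history π θ n hu huint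
      rw [← Measure.fst_compProd (S.histLaw π θ n) (S.stepKernel π θ n)] at this
      exact this.comp_measurable measurable_fst
    have h2 := S.integrable_snd_compProd_stepKernel π θ n hu huint
    rw [histLaw, integral_map (measurable_historySnoc n).aemeasurable hum.aestronglyMeasurable]
    simp only [sum_historySnoc]
    rw [integral_add h1 h2, Measure.integral_compProd h1, Measure.integral_compProd h2]
    congr 1
    · simp
    · refine integral_congr_ae ?_
      filter_upwards with h
      rw [stepKernel, ProbabilityTheory.integral_compProd]
      · rfl
      · refine ⟨hu.aestronglyMeasurable, ?_⟩
        exact (S.lintegral_enorm_stepKernel_le π θ n h hu).trans_lt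
          (ENNReal.sum_lt_top.2 fun i _ => (huint i).2)
  induction n with
  | zero => simp
  | succ n ih =>
    rw [hstep n g hg hint, ih]
    refine Eq.trans ?_ (hstep n m hm hmint).symm
    simp [hmdef]

lemma sum_comp_fst {n : ℕ} (h : BanditHistory k n) (m : Fin k → ℝ) :
    ∑ t, m (h t).1 = ∑ i, (pulls h i : ℝ) * m i := by
  rw [← Finset.sum_fiberwise_of_maps_to (s := Finset.univ) (t := Finset.univ)
    (g := fun t => (h t).1) (fun _ _ => Finset.mem_univ _)]
  refine Finset.sum_congr rfl fun i _ => ?_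
  rw [Finset.sum_congr rfl (g := fun _ => m i) (fun t ht => by
    rw [(Finset.mem_filter.1 ht).2]), Finset.sum_const, nsmul_eq_mul]
  rfl

lemma sum_pulls {n : ℕ} (h : BanditHistory k n) : ∑ i, (pulls h i : ℝ) = n := by
  have := sum_comp_fst h (fun _ => 1)
  simpa using this.symm

lemma measurable_pulls {n : ℕ} (i : Fin k) :
    Measurable fun h : BanditHistory k n => (pulls h i : ℝ) := by
  have : (fun h : BanditHistory k n => (pulls h i : ℝ)) =
      fun h => ∑ t, (fun a : Fin k => if a = i then (1 : ℝ) else 0) (h t).1 := by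
    ext h
    rw [sum_comp_fst h (fun a => if a = i then 1 else 0)]
    simp
  rw [this]
  refine Finset.measurable_sum _ fun t _ => ?_
  exact (measurable_of_finite fun a : Fin k => if a = i then (1 : ℝ) else 0).comp
    (measurable_fst.comp (measurable_pi_apply t))

lemma integrable_pulls (π : BanditPolicy k) (θ : ∀ i, Θ i) (n : ℕ) (i : Fin k) :
    Integrable (fun h => (pulls h i : ℝ)) (S.histLaw π θ n) := by
  refine Integrable.of_bound (measurable_pulls i).aestronglyMeasurable (n : ℝ)
    (ae_of_all _ fun h => ?_)
  rw [Real.norm_of_nonneg (Nat.cast_nonneg _), ← sum_pulls h]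
  exact Finset.single_le_sum (f := fun i => (pulls h i : ℝ)) (fun _ _ => Nat.cast_nonneg _)
    (Finset.mem_univ i)

lemma regret_eq_integral (π : BanditPolicy k) (θ : ∀ i, Θ i) (n : ℕ) :
    S.regret π θ n = ∫ h, (n * S.zStar θ - ∑ i, (pulls h i : ℝ) * S.mean i (θ i))
      ∂(S.histLaw π θ n) := by
  have h := S.integral_sum_history π θ n (g := Prod.snd) measurable_snd
    (fun i => S.integrable_id i (θ i))
  rw [integral_sub (integrable_const _)
    (integrable_finsetSum _ fun i _ => (S.integrable_pulls π θ n i).mul_const _)]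
  simp only [integral_const, probReal_univ, one_smul, regret]
  congr 1
  refine h.trans (integral_congr_ae (ae_of_all _ fun h => ?_))
  exact sum_comp_fst h (fun i => S.mean i (θ i))

/-- Change of measure for histories, when every bandit's law is absolutely continuous. -/
lemma lintegral_histLaw_mul_exp_le (π : BanditPolicy k) (θ θ' : ∀ i, Θ i)
    (hac : ∀ i, S.law i (θ i) ≪ S.law i (θ' i)) (n : ℕ) {G : BanditHistory k n → ℝ≥0∞}
    (hG : Measurable G) :
    ∫⁻ h, G h * ENNReal.ofReal (Real.exp (-∑ t, llr (S.law (h t).1 (θ (h t).1))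
      (S.law (h t).1 (θ' (h t).1)) (h t).2)) ∂(S.histLaw π θ n) ≤
      ∫⁻ h, G h ∂(S.histLaw π θ' n) := by
  set g : Fin k × ℝ → ℝ := fun p => llr (S.law p.1 (θ p.1)) (S.law p.1 (θ' p.1)) p.2 with hgdef
  have hg : Measurable g := measurable_from_prod_countable_right fun i =>
    measurable_llr (S.law i (θ i)) (S.law i (θ' i))
  change ∫⁻ h, G h * ENNReal.ofReal (Real.exp (-∑ t, g (h t))) ∂(S.histLaw π θ n) ≤ _
  induction n with
  | zero => simp [histLaw]
  | succ n ih =>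
    have hm : ∀ n, Measurable fun h : BanditHistory k n =>
        ENNReal.ofReal (Real.exp (-∑ t, g (h t))) := fun n => by fun_prop
    rw [S.lintegral_histLaw_succ π θ n
      (F := fun h => G h * ENNReal.ofReal (Real.exp (-∑ t, g (h t)))) (hG.mul (hm _)),
      S.lintegral_histLaw_succ π θ' n hG]
    have hGs : ∀ h : BanditHistory k n,
        Measurable fun p => G (Fin.snoc h p : BanditHistory k (n + 1)) := fun h =>
      hG.comp ((measurable_historySnoc n).comp measurable_prodMk_left)
    have hinner : Measurable fun h : BanditHistory k n =>
        ∫⁻ p, G (Fin.snoc h p : BanditHistory k (n + 1)) ∂(S.stepKernel π θ' n h) :=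
      Measurable.lintegral_kernel_prod_right' (hG.comp (measurable_historySnoc n))
    refine le_trans (lintegral_mono fun h => ?_) (ih hinner)
    simp only [sum_historySnoc, neg_add, Real.exp_add,
      ENNReal.ofReal_mul (Real.exp_pos _).le]
    have hgm : Measurable fun p => ENNReal.ofReal (Real.exp (-g p)) := by fun_prop
    simp_rw [mul_left_comm (G _)]
    have hGg : Measurable fun p => G (Fin.snoc h p : BanditHistory k (n + 1)) *
        ENNReal.ofReal (Real.exp (-g p)) := (hGs h).mul hgm
    rw [lintegral_const_mul _ hGg, mul_comm]
    refine mul_le_mul_left ?_ _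
    rw [S.lintegral_stepKernel π θ n h hGg, S.lintegral_stepKernel π θ' n h (hGs h)]
    exact lintegral_mono fun i => lintegral_mul_exp_neg_llr_le (hac i)
      ((hGs h).comp measurable_prodMk_left)

end BanditModel

namespace BanditModel

variable {k L : ℕ} {Θ : Fin k → Type*} (S : BanditModel k L Θ)

/-! ### The regret of a feasible policy -/

/-- The point of the linear program given by the activation frequencies of a history. -/
noncomputable def frequencies {n : ℕ} (h : BanditHistory k n) : Fin k ⊕ Fin L → ℝ :=
  Sum.elim (fun i => (pulls h i : ℝ) / n) (fun j => S.c₀ j - S.totalCost h j / n)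

lemma frequencies_mem_lpFeasible {n : ℕ} (hn : 1 ≤ n) {h : BanditHistory k n}
    (hh : ∀ j, S.totalCost h j / n ≤ S.c₀ j) : S.frequencies h ∈ S.lpFeasible := by
  have hn0 : (n : ℝ) ≠ 0 := by positivity
  rw [mem_lpFeasible_iff]
  refine ⟨fun j => ?_, ?_, ?_⟩
  · simp only [frequencies, Sum.elim_inl, Sum.elim_inr, totalCost]
    rw [Finset.sum_div, ← sub_eq_zero, add_sub_assoc, sub_sub_cancel_left, ← sub_eq_add_neg,
      ← Finset.sum_sub_distrib]
    exact Finset.sum_eq_zero fun i _ => by ring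
  · simp only [frequencies, Sum.elim_inl]
    rw [← Finset.sum_div, sum_pulls, div_self hn0]
  · rintro (i | j)
    · simp only [frequencies, Sum.elim_inl]; positivity
    · simpa [frequencies] using hh j

lemma mul_lpObj_dotProduct_frequencies (θ : ∀ i, Θ i) {n : ℕ} (hn : 1 ≤ n)
    (h : BanditHistory k n) :
    n * (S.lpObj θ ⬝ᵥ S.frequencies h) = ∑ i, (pulls h i : ℝ) * S.mean i (θ i) := by
  have hn0 : (n : ℝ) ≠ 0 := by positivity
  rw [lpObj_dotProduct, Finset.mul_sum]
  refine Finset.sum_congr rfl fun i _ => ?_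
  simp only [frequencies, Sum.elim_inl]
  field_simp

lemma integrable_gap (π : BanditPolicy k) (θ : ∀ i, Θ i) (n : ℕ) :
    Integrable (fun h => n * S.zStar θ - ∑ i, (pulls h i : ℝ) * S.mean i (θ i))
      (S.histLaw π θ n) :=
  (integrable_const _).sub
    (integrable_finsetSum _ fun i _ => (S.integrable_pulls π θ n i).mul_const _)

/-- Each activation of a bandit costs its reduced cost, and what remains of the resources is priced
at the nonnegative dual variables. -/
lemma sum_reducedCost_mul_le_regret {π : BanditPolicy k} (hπ : S.IsFeasible π) {θ : ∀ i, Θ i}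
    {e : Fin L ⊕ Unit → Fin k ⊕ Fin L} (he : S.IsOptimalBasis θ e) {n : ℕ} (hn : 1 ≤ n) :
    ∑ i, S.reducedCost θ e i * ∫ h, (pulls h i : ℝ) ∂(S.histLaw π θ n) ≤ S.regret π θ n := by
  have hn0 : (0 : ℝ) < n := by positivity
  obtain ⟨⟨w, hw⟩, -, hdual⟩ := he
  rw [regret_eq_integral]
  simp_rw [← integral_const_mul]
  rw [← integral_finsetSum _ fun i _ => (S.integrable_pulls π θ n i).const_mul _]
  refine integral_mono_ae (integrable_finsetSum _ fun i _ =>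
    (S.integrable_pulls π θ n i).const_mul _) (S.integrable_gap π θ n) ?_
  filter_upwards [hπ θ n hn] with h hh
  have hz : n * (S.dualVec θ e ⬝ᵥ S.lpRhs) ≤ n * S.zStar θ :=
    mul_le_mul_of_nonneg_left (S.dualVec_dotProduct_le_zStar θ hw) hn0.le
  have hslack : 0 ≤ ∑ j, S.dualVec θ e (Sum.inl j) * (n * S.c₀ j - S.totalCost h j) :=
    Finset.sum_nonneg fun j _ => mul_nonneg (hdual j) (by
      have := (div_le_iff₀ hn0).1 (hh j)
      linarith)
  have hid : ∑ i, S.reducedCost θ e i * (pulls h i : ℝ) =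
      n * (S.dualVec θ e ⬝ᵥ S.lpRhs) - ∑ i, (pulls h i : ℝ) * S.mean i (θ i) -
        ∑ j, S.dualVec θ e (Sum.inl j) * (n * S.c₀ j - S.totalCost h j) := by
    have hcost : ∑ j, S.dualVec θ e (Sum.inl j) * S.totalCost h j =
        ∑ i, (pulls h i : ℝ) * ∑ j, S.c i j * S.dualVec θ e (Sum.inl j) := by
      simp only [totalCost, Finset.mul_sum]
      rw [Finset.sum_comm]
      exact Finset.sum_congr rfl fun i _ => Finset.sum_congr rfl fun j _ => by ring
    have hrhs : S.dualVec θ e ⬝ᵥ S.lpRhs =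
        ∑ j, S.dualVec θ e (Sum.inl j) * S.c₀ j + S.dualVec θ e (Sum.inr ()) := by
      simp [dotProduct, lpRhs]
    have hlast : (n : ℝ) * S.dualVec θ e (Sum.inr ()) =
        ∑ i, (pulls h i : ℝ) * S.dualVec θ e (Sum.inr ()) := by
      rw [← Finset.sum_mul, sum_pulls]
    have hres : ∑ j, S.dualVec θ e (Sum.inl j) * (n * S.c₀ j - S.totalCost h j) =
        n * ∑ j, S.dualVec θ e (Sum.inl j) * S.c₀ j -
          ∑ j, S.dualVec θ e (Sum.inl j) * S.totalCost h j := by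
      rw [Finset.mul_sum, ← Finset.sum_sub_distrib]
      exact Finset.sum_congr rfl fun j _ => by ring
    rw [hres, hcost, hrhs, mul_add, hlast]
    simp only [reducedCost]
    rw [eq_comm, ← sub_eq_zero]
    have : ∀ a b c d f : ℝ, a + b - c - (a - d) - f = b - c + d - f := fun a b c d f => by ring
    rw [this, ← Finset.sum_sub_distrib, ← Finset.sum_add_distrib, ← Finset.sum_sub_distrib]
    exact Finset.sum_eq_zero fun i _ => by ring
  rw [hid]
  linarith

/-- If solutions with weight less than `m` on `α` fall short of the optimum by `m`, then a history
with fewer than `m n` activations of `α` loses at least `m n`, and no history gains. -/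
lemma mul_measureReal_pulls_lt_le_regret {π : BanditPolicy k} (hπ : S.IsFeasible π)
    {θ : ∀ i, Θ i} {α : Fin k} {m : ℝ}
    (hm : ∀ w ∈ S.lpFeasible, m ≤ w (Sum.inl α) ∨ m ≤ S.zStar θ - S.lpObj θ ⬝ᵥ w)
    {n : ℕ} (hn : 1 ≤ n) :
    m * n * (S.histLaw π θ n).real {h | (pulls h α : ℝ) < m * n} ≤ S.regret π θ n := by
  have hn0 : (0 : ℝ) < n := by positivity
  have hE : MeasurableSet {h : BanditHistory k n | (pulls h α : ℝ) < m * n} :=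
    measurableSet_lt (measurable_pulls α) measurable_const
  rw [regret_eq_integral, mul_comm, ← smul_eq_mul, ← integral_indicator_const _ hE]
  refine integral_mono_ae ((integrable_const _).indicator hE) (S.integrable_gap π θ n) ?_
  filter_upwards [hπ θ n hn] with h hh
  have hw := S.frequencies_mem_lpFeasible hn hh
  rw [← S.mul_lpObj_dotProduct_frequencies θ hn h, ← mul_sub]
  by_cases hh' : h ∈ {h : BanditHistory k n | (pulls h α : ℝ) < m * n}
  · rw [Set.indicator_of_mem hh', mul_comm]
    refine mul_le_mul_of_nonneg_left ((hm _ hw).resolve_left (not_le.2 ?_)) hn0.le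
    exact (div_lt_iff₀ hn0).2 hh'
  · rw [Set.indicator_of_notMem hh']
    exact mul_nonneg hn0.le (sub_nonneg.2 (S.le_zStar θ hw))

/-! ### Exploration of the critical bandits -/

/-- An event `E` that is likely under `θ` and rare under a perturbation of `θ` in the coordinate
`α` forces many activations of `α`, the only source of information that separates the two. The
bound is the expectation under `P_θ` of `1 + u ≤ exp u` for `u = l 1_E - log (dP_θ / dP_θ')`. -/
lemma mul_measureReal_le_klDiv_mul_add (π : BanditPolicy k) (θ : ∀ i, Θ i) {α : Fin k} {t : Θ α}
    (hI : InformationTheory.klDiv (S.law α (θ α)) (S.law α t) ≠ ∞) {n : ℕ}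
    {E : Set (BanditHistory k n)} (hE : MeasurableSet E) (l : ℝ) :
    l * (S.histLaw π θ n).real E ≤
      (InformationTheory.klDiv (S.law α (θ α)) (S.law α t)).toReal *
        ∫ h, (pulls h α : ℝ) ∂(S.histLaw π θ n) +
      Real.exp l * (S.histLaw π (Function.update θ α t) n).real E := by
  set θ' := Function.update θ α t
  set P := S.histLaw π θ n
  set Q := S.histLaw π θ' n
  set I := InformationTheory.klDiv (S.law α (θ α)) (S.law α t)
  have hα' : θ' α = t := Function.update_self ..
  have hne : ∀ i, i ≠ α → θ' i = θ i := fun i hi => Function.update_of_ne hi ..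
  obtain ⟨hac, hint⟩ := InformationTheory.klDiv_ne_top_iff.1 hI
  have hac' : ∀ i, S.law i (θ i) ≪ S.law i (θ' i) := fun i => by
    by_cases hi : i = α
    · subst hi; rw [hα']; exact hac
    · rw [hne i hi]
  set g : Fin k × ℝ → ℝ := fun p => llr (S.law p.1 (θ p.1)) (S.law p.1 (θ' p.1)) p.2 with hgdef
  have hg : Measurable g := measurable_from_prod_countable_right fun i =>
    measurable_llr (S.law i (θ i)) (S.law i (θ' i))
  have hgint : ∀ i, Integrable (fun x => g (i, x)) (S.law i (θ i)) := fun i => by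
    by_cases hi : i = α
    · subst hi; simp only [hgdef, hα']; exact hint
    · simp only [hgdef, hne i hi]
      exact (integrable_congr (llr_self _)).2 (integrable_zero _ _ _)
  have hgmean : ∀ i, ∫ x, g (i, x) ∂(S.law i (θ i)) = if i = α then I.toReal else 0 := fun i => by
    split_ifs with hi
    · subst hi
      simp only [hgdef, hα']
      exact (InformationTheory.toReal_klDiv_of_measure_eq hac (by simp)).symm
    · simp only [hgdef, hne i hi]
      simp [integral_congr_ae (llr_self (S.law i (θ i)))]
  have hW : ∫ h, ∑ t, g (h t) ∂P = I.toReal * ∫ h, (pulls h α : ℝ) ∂P := by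
    rw [S.integral_sum_history π θ n hg hgint, ← integral_const_mul]
    refine integral_congr_ae (ae_of_all _ fun h => ?_)
    simp only [hgmean]
    rw [sum_comp_fst h (fun i => if i = α then I.toReal else 0)]
    simp [mul_comm]
  have hSint : Integrable (fun h => ∑ t, g (h t)) P := S.integrable_sum_history π θ n hg hgint
  let u : BanditHistory k n → ℝ := E.indicator fun _ => l
  have hu : Measurable u := measurable_const.indicator hE
  have huint : Integrable u P := (integrable_const l).indicator hE
  have hexpQ : ∫⁻ h, ENNReal.ofReal (Real.exp (u h)) ∂Q ≤
      ENNReal.ofReal (1 + Real.exp l * Q.real E) := by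
    calc _ ≤ ∫⁻ h, (1 + E.indicator (fun _ => ENNReal.ofReal (Real.exp l)) h) ∂Q := by
          refine lintegral_mono fun h => ?_
          by_cases hh : h ∈ E <;> simp [u, hh]
      _ = 1 + ENNReal.ofReal (Real.exp l) * Q E := by
          rw [lintegral_add_left measurable_const, lintegral_indicator_const hE]
          simp
      _ = _ := by
          rw [ENNReal.ofReal_add zero_le_one (by positivity), ENNReal.ofReal_one,
            ENNReal.ofReal_mul (Real.exp_pos _).le, ofReal_measureReal]
  have hexpP : ∫⁻ h, ENNReal.ofReal (Real.exp (u h - ∑ t, g (h t))) ∂P ≤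
      ENNReal.ofReal (1 + Real.exp l * Q.real E) := by
    refine le_trans (le_of_eq ?_) ((S.lintegral_histLaw_mul_exp_le π θ θ' hac' n
      hu.exp.ennreal_ofReal).trans hexpQ)
    refine lintegral_congr fun h => ?_
    rw [sub_eq_add_neg, Real.exp_add, ENNReal.ofReal_mul (Real.exp_pos _).le]
  have hm : Measurable fun h : BanditHistory k n => Real.exp (u h - ∑ t, g (h t)) := by fun_prop
  have hexpint : Integrable (fun h => Real.exp (u h - ∑ t, g (h t))) P := by
    refine ⟨hm.aestronglyMeasurable, ?_⟩
    rw [hasFiniteIntegral_iff_ofReal (ae_of_all _ fun _ => (Real.exp_pos _).le)]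
    exact hexpP.trans_lt ENNReal.ofReal_lt_top
  have hle : ∫ h, Real.exp (u h - ∑ t, g (h t)) ∂P ≤ 1 + Real.exp l * Q.real E := by
    rw [integral_eq_lintegral_of_nonneg_ae (ae_of_all _ fun _ => (Real.exp_pos _).le)
      hm.aestronglyMeasurable]
    exact ENNReal.toReal_le_of_le_ofReal (by positivity) hexpP
  have hlow : ∫ h, (u h - ∑ t, g (h t) + 1) ∂P ≤ ∫ h, Real.exp (u h - ∑ t, g (h t)) ∂P :=
    integral_mono ((huint.sub hSint).add (integrable_const _)) hexpint
      fun h => Real.add_one_le_exp _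
  have hcalc : ∫ h, (u h - ∑ t, g (h t) + 1) ∂P =
      l * P.real E - I.toReal * ∫ h, (pulls h α : ℝ) ∂P + 1 := by
    have hsub : Integrable (fun h => u h - ∑ t, g (h t)) P := huint.sub hSint
    rw [integral_add hsub (integrable_const _), integral_sub huint hSint, hW,
      integral_indicator_const _ hE]
    simp [P, mul_comm]
  linarith

/-- The Lai-Robbins bound: a uniformly fast policy activates `α` asymptotically at least
`log n / I` times if `α` would be needed under the parameter `t`. -/
lemma eventually_mul_log_le_integral_pulls {π : BanditPolicy k} (hπ : S.IsFUF π) {θ : ∀ i, Θ i}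
    {α : Fin k} {t : Θ α} (ht : t ∈ S.deltaTheta θ α)
    (hI : InformationTheory.klDiv (S.law α (θ α)) (S.law α t) ≠ ∞) {c : ℝ} (hc : 0 ≤ c)
    (hcI : c * (InformationTheory.klDiv (S.law α (θ α)) (S.law α t)).toReal < 1) :
    ∀ᶠ n : ℕ in atTop, c * Real.log n ≤ ∫ h, (pulls h α : ℝ) ∂(S.histLaw π θ n) := by
  set I := (InformationTheory.klDiv (S.law α (θ α)) (S.law α t)).toReal with hIdef
  have hI0 : 0 ≤ I := ENNReal.toReal_nonneg
  set θ' := Function.update θ α t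
  obtain ⟨s, hαs, hs⟩ := ht
  obtain ⟨m, hm0, hm⟩ := S.exists_pos_le_or_le_gap (θ := θ') (α := α) (fun b hb => by
    rw [hs, Set.mem_singleton_iff] at hb
    rwa [hb])
  obtain ⟨b, hb1, hb2⟩ := exists_between hcI
  have hb0 : 0 ≤ b := (mul_nonneg hc hI0).trans hb1.le
  -- with `l = b log n`, the contribution of the perturbed law is `o(1)`
  have hlim1 : Tendsto (fun n : ℕ => S.regret π θ' n / (n : ℝ) ^ (1 - b)) atTop (nhds 0) :=
    (hπ.2 θ' (1 - b) (by linarith)).tendsto_div_nhds_zero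
  -- `l P_θ(Eᶜ)` is at most of the order `(log n)² / n` if `α` is activated `O(log n)` times
  have hlim2 : Tendsto (fun n : ℕ => Real.log n ^ 2 / (n : ℝ)) atTop (nhds 0) := by
    have := (isLittleO_log_rpow_atTop (r := 1 / 2) (by norm_num)).tendsto_div_nhds_zero
    have h2 := (this.pow 2).comp tendsto_natCast_atTop_atTop
    rw [zero_pow two_ne_zero] at h2
    refine h2.congr fun n => ?_
    simp only [Function.comp_apply, div_pow]
    rw [← Real.sqrt_eq_rpow, Real.sq_sqrt (Nat.cast_nonneg n)]
  have hlim3 : Tendsto (fun n : ℕ => b * c / m * (Real.log n ^ 2 / (n : ℝ)) +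
      m⁻¹ * (S.regret π θ' n / (n : ℝ) ^ (1 - b))) atTop (nhds 0) := by
    simpa using (hlim2.const_mul (b * c / m)).add (hlim1.const_mul m⁻¹)
  have hlog : Tendsto (fun n : ℕ => (b - c * I) * Real.log n) atTop atTop :=
    (Real.tendsto_log_atTop.comp tendsto_natCast_atTop_atTop).const_mul_atTop (sub_pos.2 hb1)
  filter_upwards [hlim3.eventually (gt_mem_nhds one_pos), hlog.eventually_ge_atTop 1,
    eventually_ge_atTop 1] with n hn1 hn2 hn
  have hn0 : (0 : ℝ) < n := by positivity
  have hlog0 : 0 ≤ Real.log n := Real.log_natCast_nonneg n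
  by_contra! hlt
  set T := ∫ h, (pulls h α : ℝ) ∂(S.histLaw π θ n)
  set E : Set (BanditHistory k n) := {h | (pulls h α : ℝ) < m * n}
  have hE : MeasurableSet E := measurableSet_lt (measurable_pulls α) measurable_const
  have hQ : m * n * (S.histLaw π θ' n).real E ≤ S.regret π θ' n :=
    S.mul_measureReal_pulls_lt_le_regret hπ.1 hm hn
  have hP : m * n * (1 - (S.histLaw π θ n).real E) ≤ T := by
    rw [← probReal_compl_eq_one_sub hE]
    have hEc : Eᶜ = {h : BanditHistory k n | m * n ≤ (pulls h α : ℝ)} := by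
      ext; simp [E]
    rw [hEc]
    exact mul_meas_ge_le_integral_of_nonneg (ae_of_all _ fun _ => Nat.cast_nonneg _)
      (S.integrable_pulls π θ n α) _
  have hmain := S.mul_measureReal_le_klDiv_mul_add π θ hI hE (b * Real.log n)
  rw [← hIdef] at hmain
  change _ ≤ I * T + _ * (S.histLaw π θ' n).real E at hmain
  have hexp : Real.exp (b * Real.log n) = (n : ℝ) / (n : ℝ) ^ (1 - b) := by
    rw [mul_comm, ← Real.rpow_def_of_pos hn0, Real.rpow_sub hn0, Real.rpow_one]
    field_simp
  have hQ' : Real.exp (b * Real.log n) * (S.histLaw π θ' n).real E ≤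
      m⁻¹ * (S.regret π θ' n / (n : ℝ) ^ (1 - b)) := by
    have hpow : 0 < (n : ℝ) ^ (1 - b) := Real.rpow_pos_of_pos hn0 _
    have hdiv : (S.histLaw π θ' n).real E * n ≤ m⁻¹ * S.regret π θ' n := by
      rw [← div_eq_inv_mul, le_div_iff₀ hm0]
      linarith
    rw [hexp, ← mul_div_assoc, div_mul_eq_mul_div, mul_comm]
    exact div_le_div_of_nonneg_right hdiv hpow.le
  have hP' : b * Real.log n * (1 - (S.histLaw π θ n).real E) ≤
      b * c / m * (Real.log n ^ 2 / (n : ℝ)) := by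
    have h1 : 1 - (S.histLaw π θ n).real E ≤ c * Real.log n / (m * n) := by
      rw [le_div_iff₀ (by positivity)]
      linarith
    refine (mul_le_mul_of_nonneg_left h1 (mul_nonneg hb0 hlog0)).trans_eq ?_
    field_simp
  have hIT : I * T ≤ I * (c * Real.log n) := mul_le_mul_of_nonneg_left hlt.le hI0
  nlinarith

lemma inv_klDiv_le_liminf {π : BanditPolicy k} (hπ : S.IsFUF π) {θ : ∀ i, Θ i}
    {α : Fin k} {t : Θ α} (ht : t ∈ S.deltaTheta θ α) :
    (InformationTheory.klDiv (S.law α (θ α)) (S.law α t))⁻¹ ≤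
      liminf (fun n : ℕ => ENNReal.ofReal
        ((∫ h, (pulls h α : ℝ) ∂(S.histLaw π θ n)) / Real.log n)) atTop := by
  by_cases hI : InformationTheory.klDiv (S.law α (θ α)) (S.law α t) = ∞
  · simp [hI]
  refine ENNReal.le_of_forall_nnreal_lt fun c hc => ?_
  have hcI : (c : ℝ) * (InformationTheory.klDiv (S.law α (θ α)) (S.law α t)).toReal < 1 := by
    have hlt : (c : ℝ≥0∞) * InformationTheory.klDiv (S.law α (θ α)) (S.law α t) < 1 := by
      rw [← ENNReal.lt_div_iff_mul_lt (Or.inr ENNReal.coe_ne_top) (Or.inl hI), one_div]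
      exact hc
    simpa using ENNReal.toReal_strict_mono ENNReal.one_ne_top hlt
  refine le_liminf_of_le (by isBoundedDefault) ?_
  filter_upwards [S.eventually_mul_log_le_integral_pulls hπ ht hI c.2 hcI,
    eventually_ge_atTop 2] with n hn hn2
  have hlog : 0 < Real.log n := Real.log_pos (by exact_mod_cast hn2)
  rw [← ENNReal.ofReal_coe_nnreal]
  exact ENNReal.ofReal_le_ofReal ((le_div_iff₀ hlog).2 hn)

lemma inv_minKL_le_liminf {π : BanditPolicy k} (hπ : S.IsFUF π) (θ : ∀ i, Θ i) (α : Fin k) :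
    (S.minKL θ α)⁻¹ ≤ liminf (fun n : ℕ => ENNReal.ofReal
        ((∫ h, (pulls h α : ℝ) ∂(S.histLaw π θ n)) / Real.log n)) atTop := by
  simp only [minKL, ENNReal.inv_iInf]
  exact iSup₂_le fun t ht => S.inv_klDiv_le_liminf hπ ht

end BanditModel

/-! ### The lower bound -/

/-- Superadditivity of the lower limit, as Fatou's lemma for the counting measure. -/
lemma ENNReal.sum_liminf_le {ι : Type*} [Fintype ι] (v : ℕ → ι → ℝ≥0∞) :
    ∑ i, liminf (fun n => v n i) atTop ≤ liminf (fun n => ∑ i, v n i) atTop := by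
  let _ : MeasurableSpace ι := ⊤
  have := lintegral_liminf_le (μ := Measure.count) (u := atTop) (f := v)
    fun n => measurable_of_finite (v n)
  simpa [lintegral_fintype] using this

theorem theorem1 {k L : ℕ} {Θ : Fin k → Type*} (S : BanditModel k L Θ) (π : BanditPolicy k)
    (hπ : S.IsFUF π) (θ : ∀ i, Θ i) (B : Fin L ⊕ Unit → Fin k ⊕ Fin L)
    (hB : S.IsOptimalBasis θ B) :
    (S.lowerBound θ B : EReal) ≤
      liminf (fun n : ℕ => ((S.regret π θ n / Real.log n : ℝ) : EReal)) atTop := by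
  set v : ℕ → Fin k → ℝ≥0∞ := fun n i => ENNReal.ofReal (S.reducedCost θ B i) *
    ENNReal.ofReal ((∫ h, (BanditModel.pulls h i : ℝ) ∂(S.histLaw π θ n)) / Real.log n) with hv
  have h1 : S.lowerBound θ B ≤ liminf (fun n => ∑ i, v n i) atTop := by
    refine le_trans ?_ (ENNReal.sum_liminf_le v)
    rw [BanditModel.lowerBound]
    refine (Finset.sum_le_sum_of_subset (Finset.subset_univ _)).trans
      (Finset.sum_le_sum fun i _ => ?_)
    simp only [hv]
    rw [ENNReal.liminf_const_mul_of_ne_top ENNReal.ofReal_ne_top, div_eq_mul_inv]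
    exact mul_le_mul_right (S.inv_minKL_le_liminf hπ θ i) _
  have h2 : ((liminf (fun n => ∑ i, v n i) atTop : ℝ≥0∞) : EReal) =
      liminf (fun n => ((∑ i, v n i : ℝ≥0∞) : EReal)) atTop :=
    Monotone.map_liminf_of_continuousAt (fun a b h => EReal.coe_ennreal_le_coe_ennreal_iff.2 h) _
      continuous_coe_ennreal_ereal.continuousAt
  refine (EReal.coe_ennreal_le_coe_ennreal_iff.2 h1).trans (h2.le.trans ?_)
  refine liminf_le_liminf ?_
  filter_upwards [eventually_ge_atTop 1] with n hn
  have hlog : 0 ≤ Real.log n := Real.log_natCast_nonneg n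
  have hT : ∀ i, 0 ≤ ∫ h, (BanditModel.pulls h i : ℝ) ∂(S.histLaw π θ n) := fun i =>
    integral_nonneg fun _ => Nat.cast_nonneg _
  have hterm : ∀ i, 0 ≤ S.reducedCost θ B i *
      ((∫ h, (BanditModel.pulls h i : ℝ) ∂(S.histLaw π θ n)) / Real.log n) := fun i =>
    mul_nonneg (hB.2.1 i) (div_nonneg (hT i) hlog)
  have hsum : ∑ i, v n i = ENNReal.ofReal (∑ i, S.reducedCost θ B i *
      ((∫ h, (BanditModel.pulls h i : ℝ) ∂(S.histLaw π θ n)) / Real.log n)) := by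
    rw [ENNReal.ofReal_sum_of_nonneg fun i _ => hterm i]
    exact Finset.sum_congr rfl fun i _ => (ENNReal.ofReal_mul (hB.2.1 i)).symm
  rw [hsum, EReal.coe_ennreal_ofReal, max_eq_left (Finset.sum_nonneg fun i _ => hterm i),
    EReal.coe_le_coe_iff]
  simp_rw [← mul_div_assoc]
  rw [← Finset.sum_div]
  exact div_le_div_of_nonneg_right (S.sum_reducedCost_mul_le_regret hπ.1 hB hn) hlog
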